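/- Rings are associative with identity $1$ (not necessarily commutative), and subrings contain $1$. Call a ring noetherian if it is both left and right noetherian, and call a ring $R$ F-noetherian if every finite subset of $R$ is contained in a noetherian subring of $R$. Let $K$ be an F-noetherian ring, let $G$ be a group, and let $K[G]$ be the group algebra of $G$ over $K$, in which the elements of $K$ commute with the elements of $G$. 1. If $G$ is locally finite (every finitely generated subgroup of $G$ is finite), then $K[G]$ is F-noetherian. 2. If $G$ is polycyclic-by-finite, then $K[G]$ is F-noetherian. Here a group $H$ is polycyclic if it has a finite series $1=H_0\le H_1\le\dots\le H_n=H$ of subgroups such that each $H_i$ is normal in $H_{i+1}$ and each quotient $H_{i+1}/H_i$ is cyclic, and $G$ is polycyclic-by-finite if it has a polycyclic normal subgroup $H$ of finite index. -/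

import Mathlib

/-- A ring is noetherian when it is both left and right noetherian. -/
def IsTwoSidedNoetherian (R : Type*) [Ring R] : Prop :=
  IsNoetherianRing R ∧ IsNoetherianRing Rᵐᵒᵖ

/-- A ring is F-noetherian when every finite subset lies in a (left and right) noetherian
unital subring. -/
def IsFNoetherian (R : Type*) [Ring R] : Prop :=
  ∀ X : Finset R, ∃ S : Subring R, (X : Set R) ⊆ (S : Set R) ∧ IsTwoSidedNoetherian S

/-- A group is locally finite when every finitely generated subgroup is finite. -/
def IsLocallyFiniteGroup (G : Type*) [Group G] : Prop :=
  ∀ H : Subgroup G, H.FG → Finite H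

/-- A group is polycyclic when it has a finite series `⊥ = H 0 ≤ H 1 ≤ ⋯ ≤ H n = ⊤`,
each term normal in the next with cyclic quotient. -/
def IsPolycyclicGroup (G : Type*) [Group G] : Prop :=
  ∃ (n : ℕ) (H : ℕ → Subgroup G), H 0 = ⊥ ∧ H n = ⊤ ∧
    ∀ i < n, H i ≤ H (i + 1) ∧
      ∃ _ : ((H i).subgroupOf (H (i + 1))).Normal,
        IsCyclic (H (i + 1) ⧸ (H i).subgroupOf (H (i + 1)))

/-- A group is polycyclic-by-finite when it has a polycyclic normal subgroup of finite index. -/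
def IsPolycyclicByFiniteGroup (G : Type*) [Group G] : Prop :=
  ∃ N : Subgroup G, N.Normal ∧ N.FiniteIndex ∧ IsPolycyclicGroup N

/-! A finite subset of `K[G]` has its coefficients in a noetherian subring `S` of `K` and its
support in a subgroup `H`: a finite one if `G` is locally finite, all of `G` otherwise. It lies in
the image of `S[H]`, so noetherianity of `S[H]` suffices. On the left, finite groups and finite
index give finite modules; each cyclic step of a polycyclic series is a Hilbert basis argument
(`isNoetherianRing_of_normalizing_unit`). The right side follows because the opposite of `S[H]` is
`Sᵐᵒᵖ[H]`. -/

/-! ### A Hilbert basis theorem for rings generated by a normalizing unit -/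

section NormalizingUnit

variable {S T : Type*} [Ring S] [Ring T]

/-- The sums `∑ i < n, x ^ i * f (s i)`, for a ring homomorphism `f : S →+* T` and `x : T`. -/
def degreeLTSums (f : S →+* T) (x : T) : ℕ → AddSubgroup T
  | 0 => ⊥
  | n + 1 => degreeLTSums f x n ⊔ ((AddMonoidHom.mulLeft (x ^ n)).comp f.toAddMonoidHom).range

theorem mem_degreeLTSums_succ {f : S →+* T} {x : T} {n : ℕ} {p : T} :
    p ∈ degreeLTSums f x (n + 1) ↔ ∃ t ∈ degreeLTSums f x n, ∃ s, t + x ^ n * f s = p := by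
  simp [degreeLTSums, AddSubgroup.mem_sup]

theorem degreeLTSums_mono (f : S →+* T) (x : T) : Monotone (degreeLTSums f x) :=
  monotone_nat_of_le_succ fun _ => le_sup_left

theorem pow_mul_mem_degreeLTSums (f : S →+* T) (x : T) (n : ℕ) (s : S) :
    x ^ n * f s ∈ degreeLTSums f x (n + 1) :=
  mem_degreeLTSums_succ.2 ⟨0, zero_mem _, s, zero_add _⟩

theorem mul_mem_degreeLTSums_succ {f : S →+* T} {x : T} {n : ℕ} {p : T}
    (hp : p ∈ degreeLTSums f x n) : x * p ∈ degreeLTSums f x (n + 1) := by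
  induction n generalizing p with
  | zero =>
    obtain rfl : p = 0 := hp
    simp
  | succ n ih =>
    obtain ⟨t, ht, s, rfl⟩ := mem_degreeLTSums_succ.1 hp
    rw [mul_add, ← mul_assoc, ← pow_succ']
    exact mem_degreeLTSums_succ.2 ⟨_, ih ht, s, rfl⟩

theorem pow_mul_mem_degreeLTSums_add {f : S →+* T} {x : T} {n : ℕ} {p : T}
    (hp : p ∈ degreeLTSums f x n) (m : ℕ) : x ^ m * p ∈ degreeLTSums f x (n + m) := by
  induction m with
  | zero => simpa using hp
  | succ m ih =>
    rw [pow_succ', mul_assoc, ← add_assoc]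
    exact mul_mem_degreeLTSums_succ ih

theorem exists_map_mul_pow {f : S →+* T} {x : T} (h : ∀ r, ∃ r', f r * x = x * f r') (n : ℕ)
    (r : S) : ∃ r', f r * x ^ n = x ^ n * f r' := by
  induction n with
  | zero => exact ⟨r, by simp⟩
  | succ n ih =>
    obtain ⟨r', hr'⟩ := ih
    obtain ⟨r'', hr''⟩ := h r'
    exact ⟨r'', by rw [pow_succ, ← mul_assoc, hr', mul_assoc, hr'', mul_assoc]⟩

theorem exists_pow_mul_map {f : S →+* T} {x : T} (h : ∀ r, ∃ r', x * f r = f r' * x) (n : ℕ)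
    (r : S) : ∃ r', x ^ n * f r = f r' * x ^ n := by
  induction n with
  | zero => exact ⟨r, by simp⟩
  | succ n ih =>
    obtain ⟨r', hr'⟩ := ih
    obtain ⟨r'', hr''⟩ := h r'
    exact ⟨r'', by rw [pow_succ', mul_assoc, hr', ← mul_assoc, hr'', mul_assoc]⟩

theorem map_mul_mem_degreeLTSums {f : S →+* T} {x : T} (h : ∀ r, ∃ r', f r * x = x * f r')
    (r : S) {n : ℕ} {p : T} (hp : p ∈ degreeLTSums f x n) : f r * p ∈ degreeLTSums f x n := by
  induction n generalizing p with
  | zero =>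
    obtain rfl : p = 0 := hp
    simp
  | succ n ih =>
    obtain ⟨t, ht, s, rfl⟩ := mem_degreeLTSums_succ.1 hp
    obtain ⟨r', hr'⟩ := exists_map_mul_pow h n r
    exact mem_degreeLTSums_succ.2
      ⟨_, ih ht, r' * s, by rw [mul_add, ← mul_assoc, hr', map_mul, mul_assoc]⟩

/-- The left ideal of coefficients of `x ^ n` in the elements of the left ideal `I` that are sums
of terms of degree at most `n`, with coefficients written on the right. -/
def topCoeffIdeal (f : S →+* T) (x : T) (hl : ∀ r, ∃ r', f r * x = x * f r')
    (hr : ∀ r, ∃ r', x * f r = f r' * x) (I : Ideal T) (n : ℕ) : Ideal S where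
  carrier := {s | ∃ t ∈ degreeLTSums f x n, t + x ^ n * f s ∈ I}
  zero_mem' := ⟨0, zero_mem _, by simp⟩
  add_mem' := by
    rintro a b ⟨t, ht, hta⟩ ⟨u, hu, hub⟩
    refine ⟨t + u, add_mem ht hu, ?_⟩
    rw [map_add, mul_add, add_add_add_comm]
    exact add_mem hta hub
  smul_mem' := by
    rintro r s ⟨t, ht, hts⟩
    -- Multiplying by `f r'` instead of `f r` makes the factor arrive as `r` to the right of `x ^
    -- n`.
    obtain ⟨r', hr'⟩ := exists_pow_mul_map hr n r
    refine ⟨f r' * t, map_mul_mem_degreeLTSums hl r' ht, ?_⟩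
    rw [smul_eq_mul, map_mul, ← mul_assoc, hr', mul_assoc, ← mul_add]
    exact I.mul_mem_left _ hts

variable {f : S →+* T} {x : T} {hl : ∀ r, ∃ r', f r * x = x * f r'}
  {hr : ∀ r, ∃ r', x * f r = f r' * x}

theorem topCoeffIdeal_mono_left (n : ℕ) : Monotone fun I => topCoeffIdeal f x hl hr I n :=
  fun _ _ hIJ _ ⟨t, ht, hs⟩ => ⟨t, ht, hIJ hs⟩

theorem topCoeffIdeal_mono_right (I : Ideal T) : Monotone (topCoeffIdeal f x hl hr I) := by
  refine monotone_nat_of_le_succ fun n s => ?_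
  rintro ⟨t, ht, hs⟩
  refine ⟨x * t, mul_mem_degreeLTSums_succ ht, ?_⟩
  rw [pow_succ', mul_assoc, ← mul_add]
  exact I.mul_mem_left _ hs

/-- Subtracting an element of `I` with the same top coefficient lowers the degree. A power of `x`
first clears negative degrees, and `x'` undoes it. -/
theorem le_of_topCoeffIdeal_le {I J : Ideal T} (hIJ : I ≤ J)
    (h : ∀ n, topCoeffIdeal f x hl hr J n ≤ topCoeffIdeal f x hl hr I n)
    {x' : T} (hx' : x' * x = 1) (hT : ∀ y : T, ∃ m n, x ^ m * y ∈ degreeLTSums f x n) :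
    J ≤ I := by
  have key : ∀ n, ∀ y ∈ degreeLTSums f x n, y ∈ J → y ∈ I := by
    intro n
    induction n with
    | zero =>
      intro y hy _
      obtain rfl : y = 0 := hy
      exact zero_mem _
    | succ n ih =>
      intro y hy hyJ
      obtain ⟨t, ht, s, rfl⟩ := mem_degreeLTSums_succ.1 hy
      obtain ⟨u, hu, huI⟩ := h n ⟨t, ht, hyJ⟩
      have hd := ih (t - u) (sub_mem ht hu) (by simpa using sub_mem hyJ (hIJ huI))
      convert add_mem hd huI using 1
      abel
  intro y hy
  obtain ⟨m, n, hmn⟩ := hT y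
  have hmem := I.mul_mem_left (x' ^ m) (key n _ hmn (J.mul_mem_left _ hy))
  rwa [← mul_assoc, pow_mul_pow_eq_one m hx', one_mul] at hmem

/-- A doubly indexed ascending family in a partial order with the ascending chain condition
stabilizes in one index, uniformly in the other. -/
theorem exists_uniform_stabilization {α : Type*} [PartialOrder α] [WellFoundedGT α]
    (F : ℕ → ℕ → α) (h₁ : ∀ n, Monotone (F n)) (h₂ : ∀ k, Monotone fun n => F n k) :
    ∃ k₀, ∀ n, ∀ k, k₀ ≤ k → F n k = F n k₀ := by
  have stab : ∀ g : ℕ →o α, ∃ n, ∀ m, n ≤ m → g n = g m :=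
    wellFoundedGT_iff_monotone_chain_condition.1 inferInstance
  obtain ⟨d, hd⟩ := stab ⟨fun i => F i i, fun i j hij => (h₁ i hij).trans (h₂ j hij)⟩
  choose c hc using fun n => stab ⟨F n, h₁ n⟩
  replace hd : ∀ m, d ≤ m → F d d = F m m := hd
  replace hc : ∀ n m, c n ≤ m → F n (c n) = F n m := hc
  have large : ∀ n k, d ≤ n → d ≤ k → F n k = F d d := by
    intro n k hn hk
    refine le_antisymm ?_ ((h₁ d hk).trans (h₂ k hn))
    rw [hd (max n k) (hn.trans (le_max_left _ _))]
    exact (h₁ n (le_max_right n k)).trans (h₂ _ (le_max_left n k))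
  -- Rows from `d` on are settled by the diagonal; the finitely many others have their own bounds
  -- `c`.
  refine ⟨max d ((Finset.range d).sup c), fun n k hk => ?_⟩
  rcases lt_or_ge n d with hn | hn
  · have hcn : c n ≤ max d ((Finset.range d).sup c) :=
      (Finset.le_sup (Finset.mem_range.2 hn)).trans (le_max_right _ _)
    rw [← hc n _ hcn, ← hc n _ (hcn.trans hk)]
  · rw [large n _ hn (le_max_left _ _), large n k hn ((le_max_left _ _).trans hk)]

/-- Hilbert basis theorem: if `T` is generated over the image of a left noetherian ring `S` by a
unit `x` normalizing that image (and its inverse), then `T` is left noetherian. -/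
theorem isNoetherianRing_of_normalizing_unit [IsNoetherianRing S] (f : S →+* T) {x x' : T}
    (hx' : x' * x = 1) (hl : ∀ r, ∃ r', f r * x = x * f r') (hr : ∀ r, ∃ r', x * f r = f r' * x)
    (hT : ∀ y : T, ∃ m n, x ^ m * y ∈ degreeLTSums f x n) : IsNoetherianRing T := by
  refine monotone_stabilizes_iff_noetherian.1 fun I => ?_
  obtain ⟨k₀, hk₀⟩ := exists_uniform_stabilization
    (fun n k => topCoeffIdeal f x hl hr (I k) n)
    (fun n _ _ hij => topCoeffIdeal_mono_left n (I.monotone hij)) (fun k => topCoeffIdeal_mono_right (I k))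
  exact ⟨k₀, fun k hk => le_antisymm (I.monotone hk)
    (le_of_topCoeffIdeal_le (I.monotone hk) (fun n => (hk₀ n k hk).le) hx' hT)⟩

end NormalizingUnit

/-- A ring generated by a finite set as a left module over a left noetherian ring is left
noetherian. -/
theorem isNoetherianRing_of_finite_generation {S T : Type*} [Ring S] [Ring T] [IsNoetherianRing S]
    (f : S →+* T) (Y : Set T) (hY : Y.Finite)
    (h : ∀ A : AddSubgroup T, (∀ s, ∀ y ∈ Y, f s * y ∈ A) → A = ⊤) : IsNoetherianRing T := by
  let _ : Module S T := Module.compHom T f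
  have : IsScalarTower S T T := ⟨fun s a b => mul_assoc (f s) a b⟩
  have : Module.Finite S T := by
    refine ⟨⟨hY.toFinset, ?_⟩⟩
    have hA := h (Submodule.span S Y).toAddSubgroup fun s y hy =>
      (Submodule.span S Y).smul_mem s (Submodule.subset_span hy)
    rw [hY.coe_toFinset]
    exact Submodule.toAddSubgroup_injective hA
  exact isNoetherian_of_tower S inferInstance

/-! ### Group rings over left noetherian rings -/

section GroupRing

open MonoidAlgebra

variable (R : Type*) [Ring R] {G : Type*} [Group G]

theorem addSubgroup_eq_top_of_single_mem {R : Type*} [Ring R] {A : AddSubgroup (MonoidAlgebra R G)}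
    (h : ∀ g r, single g r ∈ A) : A = ⊤ :=
  (AddSubgroup.eq_top_iff' A).2 fun p =>
    MonoidAlgebra.induction_linear p (zero_mem A) (fun _ _ => add_mem) h

theorem isNoetherianRing_monoidAlgebra_of_finite [Finite G] [IsNoetherianRing R] :
    IsNoetherianRing (MonoidAlgebra R G) := by
  refine isNoetherianRing_of_finite_generation (singleOneRingHom : R →+* MonoidAlgebra R G)
    (Set.range fun g : G => single g (1 : R)) (Set.finite_range _) fun A hA => ?_
  refine addSubgroup_eq_top_of_single_mem fun g r => ?_
  simpa [single_mul_single] using hA r _ ⟨g, rfl⟩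

theorem isNoetherianRing_monoidAlgebra_of_finiteIndex (H : Subgroup G) [H.FiniteIndex]
    [IsNoetherianRing (MonoidAlgebra R H)] : IsNoetherianRing (MonoidAlgebra R G) := by
  refine isNoetherianRing_of_finite_generation (mapDomainRingHom R H.subtype)
    (Set.range fun q : G ⧸ H => single (q.out⁻¹) (1 : R)) (Set.finite_range _) fun A hA => ?_
  refine addSubgroup_eq_top_of_single_mem fun g r => ?_
  -- A left module over `R[H]` needs right coset representatives: inverses of left ones.
  have hg : g * ((g⁻¹ : G) : G ⧸ H).out ∈ H := by
    simpa using QuotientGroup.eq.1 (QuotientGroup.out_eq' ((g⁻¹ : G) : G ⧸ H)).symm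
  simpa [single_mul_single] using hA (single ⟨_, hg⟩ r) _ ⟨((g⁻¹ : G) : G ⧸ H), rfl⟩

theorem isNoetherianRing_monoidAlgebra_of_isCyclic_quotient (H : Subgroup G) [H.Normal]
    [IsCyclic (G ⧸ H)] [IsNoetherianRing (MonoidAlgebra R H)] :
    IsNoetherianRing (MonoidAlgebra R G) := by
  obtain ⟨q, hq⟩ := IsCyclic.exists_generator (α := G ⧸ H)
  obtain ⟨x, rfl⟩ := QuotientGroup.mk_surjective q
  set f := mapDomainRingHom R H.subtype with hf
  have hfs : ∀ (h : H) (r : R), f (single h r) = single (h : G) r := by simp [hf]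
  have hpow : ∀ n : ℕ, (single x 1 : MonoidAlgebra R G) ^ n = single (x ^ n) 1 := by
    simp [single_pow]
  have hN : H.Normal := inferInstance
  refine isNoetherianRing_of_normalizing_unit f (x := single x 1) (x' := single x⁻¹ 1)
    (by simp [single_mul_single, one_def]) (fun p => ?_) (fun p => ?_) (fun p => ?_)
  · induction p using MonoidAlgebra.induction_linear with
    | zero => exact ⟨0, by simp⟩
    | add a b ha hb =>
      obtain ⟨a', ha⟩ := ha
      obtain ⟨b', hb⟩ := hb
      exact ⟨a' + b', by rw [map_add, map_add, add_mul, mul_add, ha, hb]⟩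
    | single h r =>
      refine ⟨single ⟨x⁻¹ * h * x, by simpa using hN.conj_mem h h.2 x⁻¹⟩ r, ?_⟩
      rw [hfs, hfs, single_mul_single, single_mul_single]
      simp [mul_assoc]
  · induction p using MonoidAlgebra.induction_linear with
    | zero => exact ⟨0, by simp⟩
    | add a b ha hb =>
      obtain ⟨a', ha⟩ := ha
      obtain ⟨b', hb⟩ := hb
      exact ⟨a' + b', by rw [map_add, map_add, add_mul, mul_add, ha, hb]⟩
    | single h r =>
      refine ⟨single ⟨x * h * x⁻¹, hN.conj_mem h h.2 x⟩ r, ?_⟩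
      rw [hfs, hfs, single_mul_single, single_mul_single]
      simp
  · induction p using MonoidAlgebra.induction_linear with
    | zero => exact ⟨0, 0, by simp⟩
    | add a b ha hb =>
      obtain ⟨m, n, ha⟩ := ha
      obtain ⟨k, l, hb⟩ := hb
      refine ⟨m + k, max (n + k) (l + m), ?_⟩
      rw [mul_add]
      refine add_mem (degreeLTSums_mono _ _ (le_max_left _ _) ?_)
        (degreeLTSums_mono _ _ (le_max_right _ _) ?_)
      · rw [add_comm m, pow_add, mul_assoc]
        exact pow_mul_mem_degreeLTSums_add ha k
      · rw [pow_add, mul_assoc]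
        exact pow_mul_mem_degreeLTSums_add hb m
    | single g r =>
      obtain ⟨i, hi⟩ := Subgroup.mem_zpowers_iff.1 (hq (g : G ⧸ H))
      have hg : (x ^ i)⁻¹ * g ∈ H := QuotientGroup.eq.1 (by simpa using hi)
      -- With `g = x ^ i * h`, multiplying by `x ^ |i|` gives the nonnegative exponent `|i| + i`.
      obtain ⟨n, hn⟩ : ∃ n : ℕ, (n : ℤ) = i.natAbs + i := ⟨(i.natAbs + i).toNat, by omega⟩
      refine ⟨i.natAbs, n + 1, ?_⟩
      convert pow_mul_mem_degreeLTSums f (single x 1) n (single ⟨_, hg⟩ r) using 1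
      rw [hfs, hpow, hpow, single_mul_single, single_mul_single, ← zpow_natCast x n, hn, zpow_add,
        zpow_natCast]
      simp [mul_assoc]

theorem isNoetherianRing_monoidAlgebra_of_isPolycyclicGroup (hG : IsPolycyclicGroup G)
    [IsNoetherianRing R] : IsNoetherianRing (MonoidAlgebra R G) := by
  obtain ⟨n, H, h0, hn, hH⟩ := hG
  have key : ∀ i ≤ n, IsNoetherianRing (MonoidAlgebra R (H i)) := by
    intro i
    induction i with
    | zero =>
      intro _
      rw [h0]
      exact isNoetherianRing_monoidAlgebra_of_finite R
    | succ i ih =>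
      intro hi
      obtain ⟨hle, _, _⟩ := hH i hi
      have := ih (Nat.le_of_succ_le hi)
      have := isNoetherianRing_of_ringEquiv (MonoidAlgebra R (H i))
        (mapDomainRingEquiv R (Subgroup.subgroupOfEquivOfLe hle).symm)
      exact isNoetherianRing_monoidAlgebra_of_isCyclic_quotient R ((H i).subgroupOf (H (i + 1)))
  have := key n le_rfl
  rw [hn] at this
  exact isNoetherianRing_of_ringEquiv (MonoidAlgebra R (⊤ : Subgroup G))
    (mapDomainRingEquiv R Subgroup.topEquiv)

theorem isNoetherianRing_monoidAlgebra_of_isPolycyclicByFiniteGroup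
    (hG : IsPolycyclicByFiniteGroup G) [IsNoetherianRing R] :
    IsNoetherianRing (MonoidAlgebra R G) := by
  obtain ⟨N, _, _, hN⟩ := hG
  have := isNoetherianRing_monoidAlgebra_of_isPolycyclicGroup R hN
  exact isNoetherianRing_monoidAlgebra_of_finiteIndex R N

end GroupRing

/-! ### Two-sided noetherian rings -/

theorem IsTwoSidedNoetherian.of_surjective {R S : Type*} [Ring R] [Ring S]
    (h : IsTwoSidedNoetherian R) (f : R →+* S) (hf : Function.Surjective f) :
    IsTwoSidedNoetherian S := by
  obtain ⟨_, _⟩ := h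
  refine ⟨isNoetherianRing_of_surjective R S f hf,
    isNoetherianRing_of_surjective Rᵐᵒᵖ Sᵐᵒᵖ (RingHom.op f) fun y => ?_⟩
  obtain ⟨a, ha⟩ := hf y.unop
  exact ⟨.op a, by simp [ha]⟩

/-- Inversion identifies `G` with its opposite, turning the right-hand condition into a left-hand
one over `Rᵐᵒᵖ`. -/
theorem isTwoSidedNoetherian_monoidAlgebra {G : Type*} [Group G] {R : Type*} [Ring R]
    (hR : IsTwoSidedNoetherian R)
    (hl : IsNoetherianRing R → IsNoetherianRing (MonoidAlgebra R G))
    (hr : IsNoetherianRing Rᵐᵒᵖ → IsNoetherianRing (MonoidAlgebra Rᵐᵒᵖ G)) :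
    IsTwoSidedNoetherian (MonoidAlgebra R G) := by
  refine ⟨hl hR.1, ?_⟩
  have := hr hR.2
  exact isNoetherianRing_of_ringEquiv (MonoidAlgebra Rᵐᵒᵖ G)
    ((MonoidAlgebra.mapDomainRingEquiv Rᵐᵒᵖ (MulEquiv.inv' G)).trans
      MonoidAlgebra.opRingEquiv.symm)

theorem exists_subring_of_coeff_mem {K G : Type*} [Ring K] [Group G] (S : Subring K)
    (H : Subgroup G) (hSH : IsTwoSidedNoetherian (MonoidAlgebra S H))
    (X : Set (MonoidAlgebra K G))
    (hX : ∀ p ∈ X, ∀ g ∈ p.coeff.support, g ∈ H ∧ p.coeff g ∈ S) :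
    ∃ A : Subring (MonoidAlgebra K G), X ⊆ A ∧ IsTwoSidedNoetherian A := by
  let φ : MonoidAlgebra S H →+* MonoidAlgebra K G :=
    (MonoidAlgebra.mapDomainRingHom K H.subtype).comp (MonoidAlgebra.mapRingHom H S.subtype)
  refine ⟨φ.range, fun p hp => ?_, hSH.of_surjective φ.rangeRestrict φ.rangeRestrict_surjective⟩
  rw [SetLike.mem_coe, ← MonoidAlgebra.sum_coeff_single p]
  refine sum_mem fun g hg => ?_
  obtain ⟨hgH, hgS⟩ := hX p hp g hg
  exact ⟨MonoidAlgebra.single ⟨g, hgH⟩ ⟨_, hgS⟩, by simp [φ]⟩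

theorem IsFNoetherian.exists_subring_coeff_mem {K G : Type*} [Ring K] (hK : IsFNoetherian K)
    (X : Finset (MonoidAlgebra K G)) :
    ∃ S : Subring K, IsTwoSidedNoetherian S ∧ ∀ p ∈ X, ∀ g ∈ p.coeff.support, p.coeff g ∈ S := by
  classical
  obtain ⟨S, hXS, hS⟩ := hK (X.biUnion fun p => p.coeff.support.image p.coeff)
  refine ⟨S, hS, fun p hp g hg => hXS ?_⟩
  simp only [Finset.coe_biUnion, Finset.coe_image, Set.mem_iUnion]
  exact ⟨p, hp, g, hg, rfl⟩

theorem mainTheorem11 (K : Type*) [Ring K] (hK : IsFNoetherian K) (G : Type*) [Group G] :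
    (IsLocallyFiniteGroup G → IsFNoetherian (MonoidAlgebra K G)) ∧
    (IsPolycyclicByFiniteGroup G → IsFNoetherian (MonoidAlgebra K G)) := by
  classical
  refine ⟨fun hG X => ?_, fun hG X => ?_⟩
  · obtain ⟨S, hS, hXS⟩ := hK.exists_subring_coeff_mem X
    have : Finite (Subgroup.closure ((X.biUnion fun p => p.coeff.support : Finset G) : Set G)) :=
      hG _ ⟨X.biUnion fun p => p.coeff.support, by simp⟩
    refine exists_subring_of_coeff_mem S
      (Subgroup.closure ((X.biUnion fun p => p.coeff.support : Finset G) : Set G))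
      (isTwoSidedNoetherian_monoidAlgebra hS
      (fun _ => isNoetherianRing_monoidAlgebra_of_finite _)
      (fun _ => isNoetherianRing_monoidAlgebra_of_finite _)) X
      fun p hp g hg => ⟨Subgroup.subset_closure ?_, hXS p hp g hg⟩
    exact Finset.mem_coe.2 (Finset.mem_biUnion.2 ⟨p, hp, hg⟩)
  · obtain ⟨S, hS, hXS⟩ := hK.exists_subring_coeff_mem X
    have hSG : IsTwoSidedNoetherian (MonoidAlgebra S G) := isTwoSidedNoetherian_monoidAlgebra hS
      (fun _ => isNoetherianRing_monoidAlgebra_of_isPolycyclicByFiniteGroup _ hG)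
      (fun _ => isNoetherianRing_monoidAlgebra_of_isPolycyclicByFiniteGroup _ hG)
    -- No restriction on the support is needed here, so `H = ⊤`.
    let e := MonoidAlgebra.mapDomainRingEquiv S (Subgroup.topEquiv (G := G)).symm
    exact exists_subring_of_coeff_mem S ⊤ (hSG.of_surjective e.toRingHom e.surjective) X
      fun p hp g hg => ⟨Subgroup.mem_top g, hXS p hp g hg⟩
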